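/- Let $G=(V,E)$ be a finite simple triangle-free graph with a weight function $w:E\to\mathbb{R}_{\ge 0}$, let $\Delta\ge 0$ be an integer, and suppose that every vertex of $G$ has degree at most $\Delta$. Write $w(G)=\sum_{e\in E}w(e)$, and let $$\mathrm{mac}(G)=\max_{A\subseteq V}\ \sum_{\substack{uv\in E\\ u\in A,\ v\in V\setminus A}} w(uv)$$ be the maximum weight of a cut of $G$. Then $$\mathrm{mac}(G)\ \ge\ t_\Delta\cdot w(G),\qquad\text{where}\quad t_\Delta=\frac12+\frac{3\Delta-1}{4\Delta^2+2\Delta-2}.$$ -/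

import Mathlib

namespace WeightedCut

open Classical in
/-- The weight `w(H)` of a graph `H` on a finite vertex set: the sum of `w e` over the edges `e`
of `H`. Only the values of `w` on edges matter. -/
noncomputable def weight {V : Type*} [Fintype V] (w : Sym2 V → ℝ) (H : SimpleGraph V) : ℝ :=
  ∑ e ∈ H.edgeFinset, w e

/-- The cut `(A, B)` of `G` with `B = V \ A`: the bipartite (spanning) subgraph of `G` formed by
the edges of `G` between `A` and `B`. -/
def cut {V : Type*} (G : SimpleGraph V) (A : Set V) : SimpleGraph V :=
  G.between A Aᶜ

/-- `mac(G)`: the maximum weight of a cut of `G`, over all bipartitions `(A, V \ A)` of the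
finite vertex set. One side may be empty, so that graphs with at most one vertex have a cut. -/
noncomputable def mac {V : Type*} [Fintype V] (G : SimpleGraph V) (w : Sym2 V → ℝ) : ℝ :=
  (Finset.univ : Finset (Finset V)).sup' Finset.univ_nonempty
    (fun A => weight w (cut G (A : Set V)))

end WeightedCut

/-!
By Vizing's theorem the edges of `G` split into `Δ + 1` matchings, so some matching `M` has
`w(G) ≤ (Δ + 1) w(M)`. Contracting `M` gives a graph of maximum degree at most `2 Δ - 2` and weight
`w(G) - w(M)`, which by Vizing's theorem again has a matching `N` with
`w(G) - w(M) ≤ (2 Δ - 1) w(N)`. The edges of `M` and `N` join at most four vertices into one part,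
and a triangle-free graph on at most four vertices is bipartite. Swapping the two sides in each part
independently with probability `1/2` gives a random cut that contains every edge inside a part and
each other edge with probability `1/2`, so that `2 mac(G) ≥ w(G) + w(M) + w(N)`.
-/

section PathLikeGraphs

variable {V : Type*} {K : SimpleGraph V}

theorem card_degree_le_one_le_two [Fintype V] [DecidableRel K.Adj] (hconn : K.Connected)
    (hK : ∀ v, K.degree v ≤ 2) : Finset.card {v | K.degree v ≤ 1} ≤ 2 := by
  have hedges : Fintype.card V ≤ K.edgeFinset.card + 1 := by
    simpa [SimpleGraph.edgeFinset_card] using hconn.card_vert_le_card_edgeSet_add_one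
  have hsum : ∑ v, (K.degree v + if K.degree v ≤ 1 then 1 else 0) ≤ ∑ _v : V, 2 := by
    refine Finset.sum_le_sum fun v _ => ?_
    have := hK v
    split_ifs <;> omega
  rw [Finset.sum_add_distrib, K.sum_degrees_eq_twice_card_edges, ← Finset.card_filter,
    Finset.sum_const, Finset.card_univ, smul_eq_mul] at hsum
  omega

theorem not_reachable_of_ncard_neighborSet_le_one [Finite V]
    (hK : ∀ v, (K.neighborSet v).ncard ≤ 2) {x y z : V} (hxy : x ≠ y) (hxz : x ≠ z) (hyz : y ≠ z)
    (hx : (K.neighborSet x).ncard ≤ 1) (hy : (K.neighborSet y).ncard ≤ 1)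
    (hz : (K.neighborSet z).ncard ≤ 1) (h : K.Reachable x y) : ¬ K.Reachable x z := by
  classical
  intro h'
  have := Fintype.ofFinite V
  let C := K.connectedComponentMk x
  have hdegree (v : C) : C.toSimpleGraph.degree v ≤ (K.neighborSet v).ncard := by
    rw [← SimpleGraph.card_neighborFinset_eq_degree, ← Set.ncard_coe_finset,
      ← Set.ncard_image_of_injective _ Subtype.val_injective]
    refine Set.ncard_le_ncard ?_ (Set.toFinite _)
    rintro _ ⟨u, hu, rfl⟩
    exact (C.toSimpleGraph.mem_neighborFinset v u).1 hu
  have hcard := card_degree_le_one_le_two C.connected_toSimpleGraph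
    fun v => (hdegree v).trans (hK v)
  refine hcard.not_gt (Finset.two_lt_card.2
    ⟨⟨x, rfl⟩, ?_, ⟨y, SimpleGraph.ConnectedComponent.sound h.symm⟩, ?_,
      ⟨z, SimpleGraph.ConnectedComponent.sound h'.symm⟩, ?_, ?_, ?_, ?_⟩)
  · exact Finset.mem_filter.2 ⟨Finset.mem_univ _, (hdegree _).trans hx⟩
  · exact Finset.mem_filter.2 ⟨Finset.mem_univ _, (hdegree _).trans hy⟩
  · exact Finset.mem_filter.2 ⟨Finset.mem_univ _, (hdegree _).trans hz⟩
  · exact fun h => hxy (congrArg Subtype.val h)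
  · exact fun h => hxz (congrArg Subtype.val h)
  · exact fun h => hyz (congrArg Subtype.val h)

end PathLikeGraphs

/-- A partial proper edge colouring with colours in `α`: `c s(u, v) = none` means that `uv` is not
coloured. It is defined on all of `Sym2 V`, so that no ambient graph is fixed. -/
structure PartialEdgeColoring (V α : Type*) where
  toFun : Sym2 V → Option α
  loopless : ∀ v, toFun s(v, v) = none
  proper : ∀ ⦃x v u w⦄, toFun s(v, u) = some x → toFun s(v, w) = some x → u = w

namespace PartialEdgeColoring

variable {V α : Type*}

instance : CoeFun (PartialEdgeColoring V α) fun _ => Sym2 V → Option α := ⟨toFun⟩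

/-- The set of coloured edges. -/
def support (c : PartialEdgeColoring V α) : Set (Sym2 V) := {e | c e ≠ none}

/-- The colour `x` is missing at `v`: no edge at `v` has colour `x`. -/
def Missing (c : PartialEdgeColoring V α) (v : V) (x : α) : Prop := ∀ u, c s(v, u) ≠ some x

variable {c c' : PartialEdgeColoring V α} {a b x : α} {u v w y z : V}

theorem ne_of_eq_some (h : c s(v, u) = some x) : v ≠ u := by
  rintro rfl
  simp [c.loopless] at h

theorem Missing.ne_some_left (h : c.Missing v x) (u : V) : c s(u, v) ≠ some x :=
  Sym2.eq_swap (a := v) ▸ h u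

section Recolor

open Classical in
/-- Give the edge `vw`, coloured or not, a colour missing at both of its ends. -/
noncomputable def recolor (c : PartialEdgeColoring V α) (hvw : v ≠ w) (hv : c.Missing v a)
    (hw : c.Missing w a) : PartialEdgeColoring V α where
  toFun := Function.update c s(v, w) (some a)
  loopless u := by
    rw [Function.update_of_ne, c.loopless]
    intro h
    exact hvw (Sym2.mk_isDiag_iff.1 (h ▸ Sym2.mk_isDiag_iff.2 rfl))
  proper := by
    have of_eq {x p q r} (hq : s(p, q) = s(v, w))
        (h : Function.update c s(v, w) (some a) s(p, q) = some x)
        (h' : Function.update c s(v, w) (some a) s(p, r) = some x) : q = r := by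
      rw [hq, Function.update_self, Option.some.injEq] at h
      subst h
      by_cases hr : s(p, r) = s(v, w)
      · exact Sym2.congr_right.1 (hq.trans hr.symm)
      · rw [Function.update_of_ne hr] at h'
        rcases Sym2.eq_iff.1 hq with ⟨rfl, _⟩ | ⟨rfl, _⟩
        · exact absurd h' (hv r)
        · exact absurd h' (hw r)
    intro x p q r h h'
    by_cases hq : s(p, q) = s(v, w)
    · exact of_eq hq h h'
    by_cases hr : s(p, r) = s(v, w)
    · exact (of_eq hr h' h).symm
    · rw [Function.update_of_ne hq] at h
      rw [Function.update_of_ne hr] at h'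
      exact c.proper h h'

variable {hvw : v ≠ w} {hv : c.Missing v a} {hw : c.Missing w a}

open Classical in
@[simp]
theorem recolor_self : c.recolor hvw hv hw s(v, w) = some a :=
  Function.update_self ..

open Classical in
theorem recolor_of_ne {e : Sym2 V} (he : e ≠ s(v, w)) : c.recolor hvw hv hw e = c e :=
  Function.update_of_ne he ..

theorem support_recolor : (c.recolor hvw hv hw).support = insert s(v, w) c.support := by
  ext e
  by_cases he : e = s(v, w)
  · simp [he, support]
  · simp [he, support, recolor_of_ne]

theorem missing_recolor_of_ne (hx : c.Missing u x) (huv : u ≠ v) (huw : u ≠ w) :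
    (c.recolor hvw hv hw).Missing u x := by
  intro q
  rw [recolor_of_ne]
  · exact hx q
  · intro h
    rcases Sym2.eq_iff.1 h with ⟨rfl, _⟩ | ⟨rfl, _⟩
    · exact huv rfl
    · exact huw rfl

theorem missing_recolor_of_eq_some (h : c s(v, w) = some x) :
    (c.recolor hvw hv hw).Missing v x := by
  intro q hq
  by_cases hqw : q = w
  · rw [hqw, recolor_self] at hq
    exact hv w (hq ▸ h)
  · rw [recolor_of_ne fun he => hqw (Sym2.congr_right.1 he)] at hq
    exact hqw (c.proper hq h)

end Recolor

section Kempe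

/-- The graph of the edges coloured `a` or `b`. Its components are the Kempe chains of `c`. -/
def kempeGraph (c : PartialEdgeColoring V α) (a b : α) : SimpleGraph V :=
  SimpleGraph.fromEdgeSet {e | c e = some a ∨ c e = some b}

theorem kempeGraph_adj :
    (c.kempeGraph a b).Adj u v ↔ c s(u, v) = some a ∨ c s(u, v) = some b := by
  rw [kempeGraph, SimpleGraph.fromEdgeSet_adj]
  exact and_iff_left_of_imp fun h => h.elim ne_of_eq_some ne_of_eq_some

theorem ncard_neighborSet_kempeGraph_le_two (v : V) :
    ((c.kempeGraph a b).neighborSet v).ncard ≤ 2 := by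
  refine (Set.ncard_le_ncard_of_injOn (t := {some a, some b}) (fun w => c s(v, w))
    (fun w hw => kempeGraph_adj.1 hw) ?_ (Set.toFinite _)).trans ?_
  · intro w hw u _ h
    rcases kempeGraph_adj.1 hw with hw | hw
    · exact c.proper hw (h.symm.trans hw)
    · exact c.proper hw (h.symm.trans hw)
  · exact (Set.ncard_insert_le _ _).trans_eq (by rw [Set.ncard_singleton])

theorem ncard_neighborSet_kempeGraph_le_one (h : c.Missing v a ∨ c.Missing v b) :
    ((c.kempeGraph a b).neighborSet v).ncard ≤ 1 := by
  have hsub : ((c.kempeGraph a b).neighborSet v).Subsingleton := by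
    intro w hw u hu
    rcases h with h | h
    · exact c.proper ((kempeGraph_adj.1 hw).resolve_left (h w))
        ((kempeGraph_adj.1 hu).resolve_left (h u))
    · exact c.proper ((kempeGraph_adj.1 hw).resolve_right (h w))
        ((kempeGraph_adj.1 hu).resolve_right (h u))
  have := hsub.finite.to_subtype
  exact Set.ncard_le_one_iff_subsingleton.2 hsub

theorem not_reachable_kempeGraph_of_missing [Finite V] (hvu : v ≠ u) (hvz : v ≠ z) (huz : u ≠ z)
    (hva : c.Missing v a) (hub : c.Missing u b) (hzb : c.Missing z b)
    (huv : (c.kempeGraph a b).Reachable u v) : ¬ (c.kempeGraph a b).Reachable z v := fun hzv =>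
  not_reachable_of_ncard_neighborSet_le_one ncard_neighborSet_kempeGraph_le_two hvu hvz huz
    (ncard_neighborSet_kempeGraph_le_one (.inl hva))
    (ncard_neighborSet_kempeGraph_le_one (.inr hub))
    (ncard_neighborSet_kempeGraph_le_one (.inr hzb)) huv.symm hzv.symm

open Classical in
/-- The colours after exchanging `a` and `b` on the edges of the Kempe chain through `z`. -/
noncomputable def kempeSwapFun (c : PartialEdgeColoring V α) (a b : α) (z : V) (e : Sym2 V) :
    Option α :=
  if ∃ u ∈ e, (c.kempeGraph a b).Reachable z u then (c e).map (Equiv.swap a b) else c e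

open Classical in
theorem kempeSwapFun_of_reachable (h : (c.kempeGraph a b).Reachable z u) (w : V) :
    c.kempeSwapFun a b z s(u, w) = (c s(u, w)).map (Equiv.swap a b) :=
  if_pos ⟨u, Sym2.mem_mk_left u w, h⟩

theorem kempeSwapFun_of_not_reachable (h : ¬ (c.kempeGraph a b).Reachable z u) (w : V) :
    c.kempeSwapFun a b z s(u, w) = c s(u, w) := by
  classical
  unfold kempeSwapFun
  split_ifs with hchain
  · obtain ⟨t, ht, hreach⟩ := hchain
    obtain rfl : t = w := (Sym2.mem_iff.1 ht).resolve_left fun htu => h (htu ▸ hreach)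
    have hnotKempe : ¬ (c s(u, t) = some a ∨ c s(u, t) = some b) := fun hKempe =>
      h (hreach.trans (kempeGraph_adj.2 hKempe).reachable.symm)
    rw [not_or] at hnotKempe
    cases hx : c s(u, t) with
    | none => rfl
    | some x =>
      rw [hx, Option.some.injEq, Option.some.injEq] at hnotKempe
      rw [Option.map_some, Equiv.swap_apply_of_ne_of_ne hnotKempe.1 hnotKempe.2]
  · rfl

/-- The colouring obtained by exchanging `a` and `b` on the Kempe chain through `z`. -/
noncomputable def kempeSwap (c : PartialEdgeColoring V α) (a b : α) (z : V) :
    PartialEdgeColoring V α where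
  toFun := c.kempeSwapFun a b z
  loopless v := by simp [kempeSwapFun, c.loopless]
  proper := by
    classical
    intro x v u w hu hw
    by_cases h : (c.kempeGraph a b).Reachable z v
    · rw [kempeSwapFun_of_reachable h] at hu hw
      obtain ⟨p, hp, hpx⟩ := Option.map_eq_some_iff.1 hu
      obtain ⟨q, hq, hqx⟩ := Option.map_eq_some_iff.1 hw
      obtain rfl : p = q := (Equiv.swap a b).injective (hpx.trans hqx.symm)
      exact c.proper hp hq
    · rw [kempeSwapFun_of_not_reachable h] at hu hw
      exact c.proper hu hw

theorem support_kempeSwap : (c.kempeSwap a b z).support = c.support := by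
  classical
  ext e
  simp only [support, kempeSwap, kempeSwapFun, Set.mem_ofPred_eq]
  split_ifs <;> simp

theorem missing_kempeSwap_of_reachable [DecidableEq α]
    (h : (c.kempeGraph a b).Reachable z u) (x : α) :
    (c.kempeSwap a b z).Missing u x ↔ c.Missing u (Equiv.swap a b x) := by
  refine forall_congr' fun w => not_congr ?_
  change c.kempeSwapFun a b z s(u, w) = some x ↔ _
  rw [kempeSwapFun_of_reachable h]
  cases c s(u, w) with
  | none => simp
  | some y =>
    rw [Option.map_some, Option.some.injEq, Option.some.injEq, ← Equiv.swap_apply_eq_iff]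
    convert Iff.rfl

theorem kempeSwap_of_not_reachable (h : ¬ (c.kempeGraph a b).Reachable z u) (w : V) :
    c.kempeSwap a b z s(u, w) = c s(u, w) :=
  kempeSwapFun_of_not_reachable h w

theorem missing_kempeSwap_of_not_reachable (h : ¬ (c.kempeGraph a b).Reachable z u) (x : α) :
    (c.kempeSwap a b z).Missing u x ↔ c.Missing u x := by
  simp only [Missing, kempeSwap_of_not_reachable h]

theorem missing_kempeSwap_of_ne (ha : x ≠ a) (hb : x ≠ b) (u : V) :
    (c.kempeSwap a b z).Missing u x ↔ c.Missing u x := by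
  classical
  by_cases h : (c.kempeGraph a b).Reachable z u
  · rw [missing_kempeSwap_of_reachable h, Equiv.swap_apply_of_ne_of_ne ha hb]
  · exact missing_kempeSwap_of_not_reachable h x

theorem missing_kempeSwap_self (h : c.Missing z b) : (c.kempeSwap a b z).Missing z a := by
  classical
  rwa [missing_kempeSwap_of_reachable .rfl, Equiv.swap_apply_left]

end Kempe

section Fan

/-- A Vizing fan with centre `v`, listed from its last vertex back to its first vertex `w`: the
colour of the edge from `v` to any further vertex is missing at the preceding one. -/
inductive IsFan (c : PartialEdgeColoring V α) (v w : V) : List V → Prop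
  | singleton : IsFan c v w [w]
  | cons {x : α} {y z : V} {l : List V} (hz : c s(v, z) = some x) (hy : c.Missing y x)
      (hnew : z ∉ y :: l) (hfan : IsFan c v w (y :: l)) : IsFan c v w (z :: y :: l)

variable {l l₁ l₂ : List V}

theorem IsFan.nodup (h : c.IsFan v w l) : l.Nodup := by
  induction h with
  | singleton => exact List.nodup_singleton w
  | cons _ _ hnew _ ih => exact ih.cons hnew

theorem IsFan.center_notMem (hvw : v ≠ w) (h : c.IsFan v w l) : v ∉ l := by
  induction h with
  | singleton => exact fun h => hvw (List.mem_singleton.1 h)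
  | cons hz _ _ _ ih => exact List.not_mem_cons_of_ne_of_not_mem (ne_of_eq_some hz) ih

theorem IsFan.exists_eq_append_singleton (h : c.IsFan v w l) : ∃ l', l = l' ++ [w] := by
  induction h with
  | singleton => exact ⟨[], rfl⟩
  | @cons _ _ z _ _ _ _ _ ih =>
    obtain ⟨l', hl'⟩ := ih
    exact ⟨z :: l', by rw [hl', List.cons_append]⟩

theorem IsFan.of_append (h : c.IsFan v w (l₁ ++ l₂)) (hl₂ : l₂ ≠ []) : c.IsFan v w l₂ := by
  induction l₁ with
  | nil => exact h
  | cons z l₁ ih =>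
    generalize hl : l₁ ++ l₂ = l at ih
    rw [List.cons_append, hl] at h
    cases h with
    | singleton => exact absurd (List.append_eq_nil_iff.1 hl).2 hl₂
    | cons _ _ _ hfan => exact ih hfan

theorem IsFan.mono (h : c.IsFan v w l) (hcolor : ∀ z ∈ l, z ≠ w → c' s(v, z) = c s(v, z))
    (hmissing : ∀ y ∈ l, ∀ x, c.Missing y x → c'.Missing y x) : c'.IsFan v w l := by
  induction h with
  | singleton => exact .singleton
  | @cons x y z l hz hy hnew hfan ih =>
    have hzw : z ≠ w := by
      obtain ⟨l', hl'⟩ := hfan.exists_eq_append_singleton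
      rintro rfl
      exact hnew (hl' ▸ List.mem_append_right l' (List.mem_singleton_self z))
    refine .cons ((hcolor z List.mem_cons_self hzw).trans hz)
      (hmissing y (List.mem_cons_of_mem z List.mem_cons_self) x hy) hnew
      (ih (fun q hq => hcolor q (List.mem_cons_of_mem z hq))
        fun q hq => hmissing q (List.mem_cons_of_mem z hq))

-- Recolouring the last edge of the fan with `a` frees its old colour both at the centre and at
-- the preceding vertex, so that the fan can be shortened until only the edge `vw` remains.
theorem IsFan.exists_support_eq_insert (hvw : v ≠ w) (h : c.IsFan v w (z :: l))
    (hv : c.Missing v a) (hz : c.Missing z a) :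
    ∃ c' : PartialEdgeColoring V α, c'.support = insert s(v, w) c.support := by
  induction l generalizing c z a with
  | nil =>
    cases h
    exact ⟨c.recolor hvw hv hz, support_recolor⟩
  | cons y l ih =>
    have hvl := h.center_notMem hvw
    obtain _ | @⟨x, _, _, _, hx, hy, hnew, hfan⟩ := h
    have hvz : v ≠ z := ne_of_eq_some hx
    let c₁ := c.recolor hvz hv hz
    have hmissing (p : V) (hp : p ∈ y :: l) (q : α) (h : c.Missing p q) : c₁.Missing p q :=
      missing_recolor_of_ne h (ne_of_mem_of_not_mem (List.mem_cons_of_mem z hp) hvl)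
        (ne_of_mem_of_not_mem hp hnew)
    have hfan₁ : c₁.IsFan v w (y :: l) := hfan.mono
      (fun p hp _ => recolor_of_ne fun he => hnew (Sym2.congr_right.1 he ▸ hp)) hmissing
    obtain ⟨c', hc'⟩ := ih hfan₁ (missing_recolor_of_eq_some hx)
      (hmissing y List.mem_cons_self x hy)
    refine ⟨c', hc'.trans ?_⟩
    have hzc : s(v, z) ∈ c.support := by simp [support, hx]
    rw [support_recolor, Set.insert_eq_of_mem hzc]

theorem IsFan.kempeSwap_append (hreach : ¬ (c.kempeGraph a b).Reachable z v)
    (hva : c.Missing v a) (hb : ∀ q ∈ l₁, c s(v, q) ≠ some b) (h : c.IsFan v w (l₁ ++ l₂))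
    (h₂ : (c.kempeSwap a b z).IsFan v w l₂) : (c.kempeSwap a b z).IsFan v w (l₁ ++ l₂) := by
  induction l₁ with
  | nil => exact h₂
  | cons q l₁ ih =>
    generalize hl : l₁ ++ l₂ = l at ih
    rw [List.cons_append, hl] at h ⊢
    cases h with
    | singleton => exact .singleton
    | @cons x y _ _ hq hy hnew hfan =>
      refine .cons ((kempeSwap_of_not_reachable hreach q).trans hq) ?_ hnew
        (ih (fun p hp => hb p (List.mem_cons_of_mem q hp)) hfan)
      refine (missing_kempeSwap_of_ne ?_ ?_ y).2 hy
      · exact fun hxa => hva q (hxa ▸ hq)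
      · exact fun hxb => hb q List.mem_cons_self (hxb ▸ hq)

theorem IsFan.kempeSwap (hreach : ¬ (c.kempeGraph a b).Reachable z v) (hva : c.Missing v a)
    (hb : ∀ q ∈ l, c s(v, q) ≠ some b) (h : c.IsFan v w l) : (c.kempeSwap a b z).IsFan v w l := by
  obtain ⟨l', rfl⟩ := h.exists_eq_append_singleton
  exact h.kempeSwap_append hreach hva (fun q hq => hb q (List.mem_append_left [w] hq)) .singleton

theorem IsFan.exists_support_eq_insert_of_kempeSwap (hvw : v ≠ w)
    (h : (c.kempeSwap a b z).IsFan v w (z :: l)) (hva : c.Missing v a) (hzb : c.Missing z b)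
    (hreach : ¬ (c.kempeGraph a b).Reachable z v) :
    ∃ c' : PartialEdgeColoring V α, c'.support = insert s(v, w) c.support := by
  obtain ⟨c', hc'⟩ := h.exists_support_eq_insert hvw
    ((missing_kempeSwap_of_not_reachable hreach a).2 hva) (missing_kempeSwap_self hzb)
  exact ⟨c', by rw [hc', support_kempeSwap]⟩

theorem IsFan.exists_predecessor (h : c.IsFan v w (l₁ ++ z :: l₂)) (hzw : z ≠ w)
    (hz : c s(v, z) = some x) : ∃ u l, l₂ = u :: l ∧ c.Missing u x := by
  cases h.of_append (List.cons_ne_nil z l₂) with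
  | singleton => exact absurd rfl hzw
  | @cons x' u _ l hz' hu _ _ =>
    obtain rfl : x' = x := Option.some.inj (hz'.symm.trans hz)
    exact ⟨u, l, rfl, hu⟩

-- The Kempe chain of `v` misses the predecessor `u` of `t` or the last vertex `z` of the fan: swap
-- the colours on the chain of that vertex.
theorem IsFan.exists_support_eq_insert_of_mem [Finite V] (hvw : v ≠ w)
    (hw : c s(v, w) = none) (h : c.IsFan v w (z :: l)) (hva : c.Missing v a)
    (hzb : c.Missing z b) {t : V} (ht : t ∈ z :: l) (htb : c s(v, t) = some b) :
    ∃ c' : PartialEdgeColoring V α, c'.support = insert s(v, w) c.support := by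
  have htw : t ≠ w := by
    rintro rfl
    simp [hw] at htb
  have htz : t ≠ z := fun htz => hzb.ne_some_left v (htz ▸ htb)
  obtain ⟨l₁, l₂, rfl⟩ := List.append_of_mem ((List.mem_cons.1 ht).resolve_left htz)
  have hvl := h.center_notMem hvw
  rw [← List.cons_append] at h hvl
  obtain ⟨u, l₂, rfl, hub⟩ := h.exists_predecessor htw htb
  obtain ⟨-, hnodup, hdisj⟩ := List.nodup_append.1 h.nodup
  have hfan : c.IsFan v w (u :: l₂) := by
    rw [List.append_cons] at h
    exact h.of_append (List.cons_ne_nil u l₂)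
  have hb (q : V) (hqt : q ≠ t) : c s(v, q) ≠ some b := fun hqb => hqt (c.proper hqb htb)
  have hb₂ : ∀ q ∈ u :: l₂, c s(v, q) ≠ some b := fun q hq =>
    hb q (ne_of_mem_of_not_mem hq (List.nodup_cons.1 hnodup).1)
  by_cases huv : (c.kempeGraph a b).Reachable u v
  · have huz : u ≠ z := fun huz =>
      hdisj z List.mem_cons_self u (List.mem_cons_of_mem t List.mem_cons_self) huz.symm
    have hvu : v ≠ u := fun hvu => hvl (hvu ▸ by simp)
    have hvz : v ≠ z := fun hvz => hvl (hvz ▸ by simp)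
    have hzv := not_reachable_kempeGraph_of_missing hvu hvz huz hva hub hzb huv
    have hzu : ¬ (c.kempeGraph a b).Reachable z u := fun hzu => hzv (hzu.trans huv)
    have hfan_t : (c.kempeSwap a b z).IsFan v w (t :: u :: l₂) :=
      .cons ((kempeSwap_of_not_reachable hzv t).trans htb)
        ((missing_kempeSwap_of_not_reachable hzu b).2 hub) (List.nodup_cons.1 hnodup).1
        (hfan.kempeSwap hzv hva hb₂)
    exact (h.kempeSwap_append hzv hva (fun q hq => hb q (hdisj q hq t List.mem_cons_self))
      hfan_t).exists_support_eq_insert_of_kempeSwap hvw hva hzb hzv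
  · exact (hfan.kempeSwap huv hva hb₂).exists_support_eq_insert_of_kempeSwap hvw hva hub huv

theorem exists_isFan_maximal [Finite V] (hmissing : ∀ u, ∃ x, c.Missing u x) (v w : V) :
    ∃ z l b, c.IsFan v w (z :: l) ∧ c.Missing z b ∧ ∀ t, c s(v, t) = some b → t ∈ z :: l := by
  classical
  have := Fintype.ofFinite V
  by_contra! hextend
  have hfan (n : ℕ) : ∃ z l, c.IsFan v w (z :: l) ∧ l.length = n := by
    induction n with
    | zero => exact ⟨w, [], .singleton, rfl⟩
    | succ n ih =>
      obtain ⟨z, l, h, hl⟩ := ih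
      obtain ⟨b, hb⟩ := hmissing z
      obtain ⟨t, htb, ht⟩ := hextend z l b h hb
      exact ⟨t, z :: l, .cons htb hb ht h, by rw [List.length_cons, hl]⟩
  obtain ⟨z, l, h, hl⟩ := hfan (Fintype.card V)
  have hcard := h.nodup.length_le_card
  rw [List.length_cons, hl] at hcard
  exact Nat.not_succ_le_self _ hcard

theorem exists_support_eq_insert [Finite V] (hmissing : ∀ u, ∃ x, c.Missing u x) (hvw : v ≠ w)
    (hw : c s(v, w) = none) :
    ∃ c' : PartialEdgeColoring V α, c'.support = insert s(v, w) c.support := by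
  obtain ⟨z, l, b, h, hzb, hmem⟩ := exists_isFan_maximal hmissing v w
  by_cases hvb : c.Missing v b
  · exact h.exists_support_eq_insert hvw hvb hzb
  · obtain ⟨a, hva⟩ := hmissing v
    obtain ⟨t, ht⟩ : ∃ t, c s(v, t) = some b := by simpa [Missing] using hvb
    exact h.exists_support_eq_insert_of_mem hvw hw hva hzb (hmem t ht) ht

end Fan

section Vizing

variable {G : SimpleGraph V}

theorem exists_missing_of_ncard_neighborSet_lt [Finite V] (hc : c.support ⊆ G.edgeSet)
    (hv : (G.neighborSet v).ncard < Nat.card α) :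
    ∃ x, c.Missing v x := by
  by_contra! hall
  simp only [Missing, not_forall, not_not] at hall
  choose g hg using hall
  have hinj : Function.Injective g := fun x y hxy =>
    Option.some.inj ((hg x).symm.trans (hxy ▸ hg y))
  have hrange : Set.range g ⊆ G.neighborSet v := by
    rintro _ ⟨x, rfl⟩
    exact hc (show c s(v, g x) ≠ none by simp [hg x])
  have hcard := Set.ncard_le_ncard hrange (Set.toFinite _)
  rw [← Set.image_univ, Set.ncard_image_of_injective _ hinj, Set.ncard_univ] at hcard
  exact hcard.not_gt hv

theorem exists_support_eq_edgeSet [Finite V] (hG : ∀ v, (G.neighborSet v).ncard < Nat.card α) :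
    ∃ c : PartialEdgeColoring V α, c.support = G.edgeSet := by
  refine Set.Finite.induction_on_subset (motive := fun s _ =>
    ∃ c : PartialEdgeColoring V α, c.support = s) G.edgeSet (Set.toFinite _) ?_ ?_
  · exact ⟨⟨fun _ => none, fun _ => rfl, fun _ _ _ _ h => by simp at h⟩, by simp [support]⟩
  · rintro e s he hs hes ⟨c, rfl⟩
    induction e with | _ v w
    exact exists_support_eq_insert (fun u => exists_missing_of_ncard_neighborSet_lt hs (hG u))
      (G.ne_of_adj he) (by simpa [support] using hes)

end Vizing

end PartialEdgeColoring

theorem lineGraph_colorable_maxDegree_add_one {V : Type*} [Fintype V] (G : SimpleGraph V)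
    [DecidableRel G.Adj] : G.lineGraph.Colorable (G.maxDegree + 1) := by
  have hdegree (v : V) : (G.neighborSet v).ncard < Nat.card (Fin (G.maxDegree + 1)) := by
    rw [Set.ncard_eq_toFinset_card', Nat.card_fin, Nat.lt_add_one_iff]
    exact G.degree_le_maxDegree v
  obtain ⟨c, hc⟩ := PartialEdgeColoring.exists_support_eq_edgeSet hdegree
  have hcolored (e : G.edgeSet) : ∃ x, c e = some x :=
    Option.ne_none_iff_exists'.1 (hc.ge e.2)
  choose color hcolor using hcolored
  refine ⟨.mk color fun {e f} hef heq => ?_⟩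
  obtain ⟨hne, v, ⟨u, hu⟩, ⟨w, hw⟩⟩ := SimpleGraph.lineGraph_adj_iff_exists.1 hef
  have huw : u = w := c.proper (hu ▸ hcolor e) (hw ▸ heq ▸ hcolor f)
  exact hne (Subtype.ext (by rw [hu, hw, huw]))

section TriangleFree

variable {V : Type*} {G : SimpleGraph V}

theorem isBipartite_of_isIndepSet_of_isIndepSet_compl {s : Set V} (hs : G.IsIndepSet s)
    (hs' : G.IsIndepSet sᶜ) : G.IsBipartite := by
  classical
  refine ⟨.mk (fun v => if v ∈ s then 0 else 1) fun {u v} huv heq => ?_⟩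
  by_cases hu : u ∈ s <;> by_cases hv : v ∈ s
  · exact hs hu hv huv.ne huv
  · simp [hu, hv] at heq
  · simp [hu, hv] at heq
  · exact hs' hu hv huv.ne huv

theorem exists_two_le_degree_of_not_isAcyclic [G.LocallyFinite] (hG : ¬ G.IsAcyclic) :
    ∃ v, 2 ≤ G.degree v := by
  simp only [SimpleGraph.IsAcyclic, not_forall, not_not] at hG
  obtain ⟨v, p, hp⟩ := hG
  refine ⟨v, Finset.one_lt_card.2 ⟨p.snd, ?_, p.penultimate, ?_, hp.snd_ne_penultimate⟩⟩
  · exact (G.mem_neighborFinset v _).2 (p.adj_snd hp.not_nil)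
  · exact (G.mem_neighborFinset v _).2 (p.adj_penultimate hp.not_nil).symm

theorem isBipartite_of_maxDegree_le_one [Fintype V] [DecidableRel G.Adj] (hG : G.maxDegree ≤ 1) :
    G.IsBipartite := by
  by_contra hbip
  obtain ⟨v, hv⟩ :=
    exists_two_le_degree_of_not_isAcyclic (mt SimpleGraph.IsAcyclic.isBipartite hbip)
  have := G.degree_le_maxDegree v
  omega

-- If `v` has two neighbours, then at most one vertex other than `v` is not adjacent to `v`.
theorem isBipartite_of_cliqueFree_three_of_card_le_four [Fintype V] (hG : G.CliqueFree 3)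
    (hV : Fintype.card V ≤ 4) : G.IsBipartite := by
  classical
  by_cases hacyclic : G.IsAcyclic
  · exact hacyclic.isBipartite
  obtain ⟨v, hv⟩ := exists_two_le_degree_of_not_isAcyclic hacyclic
  refine isBipartite_of_isIndepSet_of_isIndepSet_compl
    (G.isIndepSet_neighborSet_of_triangleFree hG v) fun x hx y hy hxy hadj => ?_
  have hcard : (G.neighborFinset v)ᶜ.card ≤ 2 := by
    rw [Finset.card_compl, G.card_neighborFinset_eq_degree]
    omega
  have hvx : v ≠ x := by
    rintro rfl
    exact hy hadj
  have hvy : v ≠ y := by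
    rintro rfl
    exact hx hadj.symm
  refine hcard.not_gt (Finset.two_lt_card.2 ⟨v, ?_, x, ?_, y, ?_, hvx, hvy, hxy⟩)
  · simp
  · simpa using hx
  · simpa using hy

end TriangleFree

namespace WeightedCut

section Inside

variable {V ι κ : Type*} {G : SimpleGraph V}

/-- The graph of the edges of `G` that do not leave their part of the partition of `V` into the
fibres of `p`. -/
def inside (G : SimpleGraph V) (p : V → ι) : SimpleGraph V where
  Adj u v := G.Adj u v ∧ p u = p v
  symm.symm _ _ h := ⟨h.1.symm, h.2.symm⟩
  loopless.irrefl v h := G.loopless.irrefl v h.1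

theorem inside_le (G : SimpleGraph V) (p : V → ι) : inside G p ≤ G := fun _ _ h => h.1

theorem inside_const (G : SimpleGraph V) (i : ι) : inside G (fun _ => i) = G :=
  le_antisymm (inside_le G _) fun _ _ h => ⟨h, rfl⟩

theorem isBipartite_inside {p : V → ι} (h : ∀ i, (G.induce (p ⁻¹' {i})).IsBipartite) :
    (inside G p).IsBipartite := by
  let C (i : ι) : (G.induce (p ⁻¹' {i})).Coloring (Fin 2) := (h i).some
  have hC {v : V} {i : ι} (hv : p v = i) : C (p v) ⟨v, rfl⟩ = C i ⟨v, hv⟩ := by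
    subst hv
    rfl
  refine ⟨.mk (fun v => C (p v) ⟨v, rfl⟩) fun {u v} huv => ?_⟩
  rw [hC huv.2]
  exact (C (p v)).valid huv.1

theorem card_fiber_comp_le [Fintype V] [DecidableEq ι] [DecidableEq κ] [Fintype ι] {f : V → ι}
    {g : ι → κ} {m n : ℕ} (hf : ∀ i, Finset.card {v | f v = i} ≤ m)
    (hg : ∀ k, Finset.card {i | g i = k} ≤ n) (k : κ) :
    Finset.card {v | (g ∘ f) v = k} ≤ m * n := by
  refine (Finset.card_le_mul_card_image_of_maps_to (f := f) (t := {i | g i = k}) (by simp) m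
    fun i _ => ?_).trans (Nat.mul_le_mul_left m (hg k))
  exact (Finset.card_le_card (Finset.filter_subset_filter _ (Finset.filter_subset _ _))).trans
    (hf i)

end Inside

section Matching

variable {V : Type*} {M : SimpleGraph V} {u v : V}

/-- A matching, regarded as a graph on the whole vertex set. -/
def IsMatching (M : SimpleGraph V) : Prop := ∀ v, (M.neighborSet v).Subsingleton

theorem IsMatching.reachable_iff (hM : IsMatching M) : M.Reachable u v ↔ u = v ∨ M.Adj u v := by
  refine ⟨?_, ?_⟩
  · rintro ⟨p⟩
    induction p with
    | nil => exact .inl rfl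
    | cons huv _ ih =>
      rcases ih with rfl | hvw
      · exact .inr huv
      · exact .inl (hM _ huv.symm hvw)
  · rintro (rfl | huv)
    · exact .rfl
    · exact huv.reachable

theorem IsMatching.connectedComponentMk_eq_iff (hM : IsMatching M) :
    M.connectedComponentMk u = M.connectedComponentMk v ↔ u = v ∨ M.Adj u v := by
  rw [SimpleGraph.ConnectedComponent.eq, hM.reachable_iff]

theorem IsMatching.card_fiber_connectedComponentMk_le_two [Fintype V]
    [DecidableEq M.ConnectedComponent] (hM : IsMatching M) (q : M.ConnectedComponent) :
    Finset.card {v | M.connectedComponentMk v = q} ≤ 2 := by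
  by_contra! hcard
  obtain ⟨x, hx, y, hy, z, hz, hxy, hxz, hyz⟩ := Finset.two_lt_card.1 hcard
  simp only [Finset.mem_filter_univ] at hx hy hz
  have hadj_y := (hM.connectedComponentMk_eq_iff.1 (hx.trans hy.symm)).resolve_left hxy
  have hadj_z := (hM.connectedComponentMk_eq_iff.1 (hx.trans hz.symm)).resolve_left hxz
  exact hyz (hM x hadj_y hadj_z)

theorem IsMatching.inside_connectedComponentMk {G : SimpleGraph V} (hM : IsMatching M)
    (hMG : M ≤ G) : inside G M.connectedComponentMk = M := by
  refine le_antisymm (fun u v huv => ?_) fun u v huv => ⟨hMG huv, ?_⟩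
  · exact (hM.connectedComponentMk_eq_iff.1 huv.2).resolve_left huv.1.ne
  · exact hM.connectedComponentMk_eq_iff.2 (.inr huv)

theorem isMatching_labelGraph {H : SimpleGraph V} {α : Type*} (C : H.lineGraph.Coloring α)
    (k : α) : IsMatching (SimpleGraph.EdgeLabeling.labelGraph (G := H) (fun e => C e) k) := by
  intro v x hx y hy
  obtain ⟨hvx, hCx⟩ := (SimpleGraph.EdgeLabeling.labelGraph_adj _ _).1 hx
  obtain ⟨hvy, hCy⟩ := (SimpleGraph.EdgeLabeling.labelGraph_adj _ _).1 hy
  by_contra hxy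
  refine C.valid (SimpleGraph.lineGraph_adj_iff_exists.2 ⟨?_, v, ?_, ?_⟩) (hCx.trans hCy.symm)
  · exact fun h => hxy (Sym2.congr_right.1 (congrArg Subtype.val h))
  · simp
  · simp

end Matching

section Weight

variable {V : Type*} [Fintype V] {G H : SimpleGraph V} (w : Sym2 V → ℝ)

open Classical in
theorem weight_eq_sum_ite (hHG : H ≤ G) :
    weight w H = ∑ e ∈ G.edgeFinset, if e ∈ H.edgeSet then w e else 0 := by
  rw [weight, ← Finset.sum_filter]
  congr 1
  ext e
  simpa using fun he => SimpleGraph.edgeSet_mono hHG he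

open Classical in
theorem weight_eq_sum_weight_labelGraph {α : Type*} [Fintype α] (L : G.EdgeLabeling α) :
    weight w G = ∑ k, weight w (L.labelGraph k) := by
  simp only [fun k => weight_eq_sum_ite w (L.labelGraph_le (k := k))]
  rw [Finset.sum_comm, weight]
  refine Finset.sum_congr rfl fun e he => ?_
  have hmem (k : α) : e ∈ (L.labelGraph k).edgeSet ↔ L ⟨e, by simpa using he⟩ = k := by
    induction e with
    | _ u v =>
      rw [SimpleGraph.mem_edgeFinset, SimpleGraph.mem_edgeSet] at he
      rw [SimpleGraph.mem_edgeSet, SimpleGraph.EdgeLabeling.labelGraph_adj]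
      exact ⟨fun ⟨_, h⟩ => h, fun h => ⟨he, h⟩⟩
  simp only [hmem, Finset.sum_ite_eq, Finset.mem_univ, if_true]

theorem exists_isMatching_weight_le [DecidableRel G.Adj] {d : ℕ} (hd : G.maxDegree ≤ d) :
    ∃ M ≤ G, IsMatching M ∧ weight w G ≤ (d + 1) * weight w M := by
  obtain ⟨C⟩ := (lineGraph_colorable_maxDegree_add_one G).mono (Nat.succ_le_succ hd)
  let L : G.EdgeLabeling (Fin (d + 1)) := fun e => C e
  obtain ⟨k, -, hk⟩ := Finset.exists_max_image Finset.univ (fun k => weight w (L.labelGraph k))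
    Finset.univ_nonempty
  refine ⟨L.labelGraph k, L.labelGraph_le, isMatching_labelGraph C k, ?_⟩
  rw [weight_eq_sum_weight_labelGraph w L]
  simpa using Finset.sum_le_card_nsmul Finset.univ _ _ hk

end Weight

section Contraction

variable {V W : Type*} {G M : SimpleGraph V}

theorem IsMatching.exists_adj_of_map_adj (hM : IsMatching M) {u : V} {q : M.ConnectedComponent}
    (hq : (G.map M.connectedComponentMk).Adj (M.connectedComponentMk u) q) :
    ∃ x y, (u = x ∨ M.Adj u x) ∧ G.Adj x y ∧ y ≠ u ∧ ¬ M.Adj u y ∧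
      M.connectedComponentMk y = q := by
  obtain ⟨hne, x, y, hxy, hx, rfl⟩ := (SimpleGraph.map_adj' _ _ _ _).1 hq
  refine ⟨x, y, hM.connectedComponentMk_eq_iff.1 hx.symm, hxy, ?_, ?_, rfl⟩
  · rintro rfl
    exact hne rfl
  · exact fun h => hne (hM.connectedComponentMk_eq_iff.2 (.inr h))

variable [Fintype V]

theorem IsMatching.degree_map_le_of_forall_not_adj [Fintype M.ConnectedComponent]
    [DecidableRel G.Adj] [DecidableRel (G.map M.connectedComponentMk).Adj] (hM : IsMatching M)
    {u : V} (hu : ∀ v, ¬ M.Adj u v) :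
    (G.map M.connectedComponentMk).degree (M.connectedComponentMk u) ≤ G.degree u := by
  classical
  rw [← SimpleGraph.card_neighborFinset_eq_degree, ← SimpleGraph.card_neighborFinset_eq_degree]
  refine (Finset.card_le_card (t := (G.neighborFinset u).image M.connectedComponentMk)
    fun q hq => ?_).trans Finset.card_image_le
  rw [SimpleGraph.mem_neighborFinset] at hq
  obtain ⟨x, y, rfl | hux, hxy, -, -, rfl⟩ := hM.exists_adj_of_map_adj hq
  · exact Finset.mem_image_of_mem _ (by simpa using hxy)
  · exact (hu x hux).elim

theorem IsMatching.degree_map_le_of_adj [Fintype M.ConnectedComponent] [DecidableRel G.Adj]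
    [DecidableRel (G.map M.connectedComponentMk).Adj] (hM : IsMatching M) (hMG : M ≤ G) {u v : V}
    (huv : M.Adj u v) :
    (G.map M.connectedComponentMk).degree (M.connectedComponentMk u) ≤
      (G.degree u - 1) + (G.degree v - 1) := by
  classical
  have hsub : (G.map M.connectedComponentMk).neighborFinset (M.connectedComponentMk u) ⊆
      ((G.neighborFinset u).erase v ∪ (G.neighborFinset v).erase u).image
        M.connectedComponentMk := by
    intro q hq
    rw [SimpleGraph.mem_neighborFinset] at hq
    obtain ⟨x, y, rfl | hux, hxy, hyu, hy, rfl⟩ := hM.exists_adj_of_map_adj hq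
    · have hyv : y ≠ v := fun h => hy (h ▸ huv)
      exact Finset.mem_image_of_mem _ (Finset.mem_union_left _ (by simp [hyv, hxy]))
    · obtain rfl := hM u hux huv
      exact Finset.mem_image_of_mem _ (Finset.mem_union_right _ (by simp [hyu, hxy]))
  calc (G.map M.connectedComponentMk).degree (M.connectedComponentMk u)
      ≤ ((G.neighborFinset u).erase v ∪ (G.neighborFinset v).erase u).card :=
        (Finset.card_le_card hsub).trans Finset.card_image_le
    _ ≤ ((G.neighborFinset u).erase v).card + ((G.neighborFinset v).erase u).card :=
        Finset.card_union_le _ _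
    _ = (G.degree u - 1) + (G.degree v - 1) := by
        rw [Finset.card_erase_of_mem (by simpa using hMG huv),
          Finset.card_erase_of_mem (by simpa using (hMG huv).symm),
          SimpleGraph.card_neighborFinset_eq_degree, SimpleGraph.card_neighborFinset_eq_degree]

theorem IsMatching.maxDegree_map_le [Fintype M.ConnectedComponent] [DecidableRel G.Adj]
    [DecidableRel (G.map M.connectedComponentMk).Adj] (hM : IsMatching M) (hMG : M ≤ G) {Δ : ℕ}
    (hΔ : 2 ≤ Δ) (hG : G.maxDegree ≤ Δ) : (G.map M.connectedComponentMk).maxDegree ≤ 2 * Δ - 2 := by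
  have hdegree (v : V) : G.degree v ≤ Δ := (G.degree_le_maxDegree v).trans hG
  refine SimpleGraph.maxDegree_le_of_forall_degree_le _ _ fun q => ?_
  induction q using SimpleGraph.ConnectedComponent.ind with | _ u
  by_cases hu : ∃ v, M.Adj u v
  · obtain ⟨v, huv⟩ := hu
    have := hM.degree_map_le_of_adj hMG huv
    have := hdegree u
    have := hdegree v
    omega
  · have := hM.degree_map_le_of_forall_not_adj (G := G) (not_exists.1 hu)
    have := hdegree u
    omega

open Classical in
/-- The weight that `w` induces on a contraction `f` of `G`: parallel edges are merged and their
weights are added. -/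
noncomputable def pushWeight (G : SimpleGraph V) (w : Sym2 V → ℝ) (f : V → W) (q : Sym2 W) : ℝ :=
  ∑ e ∈ G.edgeFinset with e.map f = q, w e

theorem weight_inside_comp {U : Type*} [Fintype W] (G : SimpleGraph V) (w : Sym2 V → ℝ)
    (f : V → W) (g : W → U) :
    weight w (inside G (g ∘ f)) =
      weight w (inside G f) + weight (pushWeight G w f) (inside (G.map f) g) := by
  classical
  have hfiber : weight (pushWeight G w f) (inside (G.map f) g) =
      ∑ e ∈ (inside G (g ∘ f)).edgeFinset \ (inside G f).edgeFinset, w e := by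
    rw [← Finset.sum_fiberwise_of_maps_to (g := Sym2.map f)
      (t := (inside (G.map f) g).edgeFinset)]
    · refine Finset.sum_congr rfl fun q hq => Finset.sum_congr ?_ fun _ _ => rfl
      ext e
      simp only [Finset.mem_filter, Finset.mem_sdiff, SimpleGraph.mem_edgeFinset,
        and_congr_left_iff]
      rintro rfl
      induction e with | _ u v
      rw [SimpleGraph.mem_edgeFinset, Sym2.map_mk, SimpleGraph.mem_edgeSet] at hq
      exact ⟨fun h => ⟨⟨h, hq.2⟩, fun h' => hq.1.ne h'.2⟩, fun h => h.1.1⟩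
    · intro e
      induction e with | _ u v
      simp only [Finset.mem_sdiff, SimpleGraph.mem_edgeFinset, SimpleGraph.mem_edgeSet, Sym2.map_mk]
      exact fun ⟨h, hf⟩ => ⟨(SimpleGraph.map_adj' _ _ _ _).2
        ⟨fun h' => hf ⟨h.1, h'⟩, u, v, h.1, rfl, rfl⟩, h.2⟩
  have hsub : (inside G f).edgeFinset ⊆ (inside G (g ∘ f)).edgeFinset :=
    SimpleGraph.edgeFinset_mono fun u v h => ⟨h.1, congrArg g h.2⟩
  rw [hfiber, weight, weight, add_comm]
  convert (Finset.sum_sdiff hsub).symm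

theorem weight_eq_weight_add_weight_map [Fintype W] (G : SimpleGraph V)
    (w : Sym2 V → ℝ) (f : V → W) :
    weight w G = weight w (inside G f) + weight (pushWeight G w f) (G.map f) := by
  simpa only [Function.comp_def, inside_const] using weight_inside_comp G w f fun _ => ()

end Contraction

section RandomCut

variable {V ι : Type*}

theorem cut_le (G : SimpleGraph V) (A : Set V) : cut G A ≤ G := SimpleGraph.between_le

theorem two_mul_card_xor_ne [Fintype ι] [DecidableEq ι] {i j : ι} (hij : i ≠ j) (x y : Bool) :
    2 * Finset.card {σ : ι → Bool | (x ^^ σ i) ≠ (y ^^ σ j)} = Fintype.card (ι → Bool) := by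
  have hswap : Finset.card {σ : ι → Bool | (x ^^ σ i) ≠ (y ^^ σ j)} =
      Finset.card {σ : ι → Bool | ¬ (x ^^ σ i) ≠ (y ^^ σ j)} := by
    refine Finset.card_nbij' (fun σ => Function.update σ i !σ i)
      (fun σ => Function.update σ i !σ i) ?_ ?_ ?_ ?_
    · intro σ
      simp only [Finset.coe_filter, Finset.mem_univ, true_and, Set.mem_ofPred_eq,
        Function.update_self, Function.update_of_ne hij.symm]
      cases x <;> cases y <;> cases σ i <;> cases σ j <;> decide
    · intro σ
      simp only [Finset.coe_filter, Finset.mem_univ, true_and, Set.mem_ofPred_eq,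
        Function.update_self, Function.update_of_ne hij.symm]
      cases x <;> cases y <;> cases σ i <;> cases σ j <;> decide
    · exact fun σ _ => by simp
    · exact fun σ _ => by simp
  have := Finset.card_filter_add_card_filter_not (s := (Finset.univ : Finset (ι → Bool)))
    (fun σ => (x ^^ σ i) ≠ (y ^^ σ j))
  rw [← Finset.card_univ]
  omega

/-- One side of a random cut, for fair coins `σ`: the side of the bipartition `s` with both sides
swapped in every part `p ⁻¹' {i}` for which `σ i` is `true`. -/
def flippedSide [Fintype V] (s : V → Bool) (p : V → ι) (σ : ι → Bool) : Finset V :=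
  {v | s v ^^ σ (p v)}

theorem cut_flippedSide_adj [Fintype V] {G : SimpleGraph V} {s : V → Bool} {p : V → ι}
    {σ : ι → Bool} {u v : V} :
    (cut G (flippedSide s p σ)).Adj u v ↔ G.Adj u v ∧ (s u ^^ σ (p u)) ≠ (s v ^^ σ (p v)) := by
  simp only [cut, SimpleGraph.between_adj, flippedSide, Finset.coe_filter, Finset.mem_univ,
    true_and, Set.mem_ofPred_eq, Set.mem_compl_iff]
  cases (s u ^^ σ (p u)) <;> cases (s v ^^ σ (p v)) <;> simp

open Classical in
theorem two_mul_card_mem_cut_flippedSide [Fintype V] [Fintype ι] {G : SimpleGraph V} {p : V → ι}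
    (s : (inside G p).Coloring Bool) {e : Sym2 V} (he : e ∈ G.edgeSet) :
    2 * Finset.card {σ | e ∈ (cut G (flippedSide s p σ)).edgeSet} =
      Fintype.card (ι → Bool) +
        if e ∈ (inside G p).edgeSet then Fintype.card (ι → Bool) else 0 := by
  induction e with | _ u v
  rw [SimpleGraph.mem_edgeSet] at he
  simp only [SimpleGraph.mem_edgeSet, cut_flippedSide_adj, he, true_and]
  split_ifs with huv
  · have hne (σ : ι → Bool) : (s u ^^ σ (p u)) ≠ (s v ^^ σ (p v)) := by
      simpa [huv.2] using s.valid huv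
    rw [Finset.filter_true_of_mem fun σ _ => hne σ, Finset.card_univ, two_mul]
  · exact two_mul_card_xor_ne (fun h => huv ⟨he, h⟩) (s u) (s v)

theorem weight_add_weight_inside_le_two_mul_mac [Fintype V] [Finite ι] (G : SimpleGraph V)
    (w : Sym2 V → ℝ) {p : V → ι} (hp : (inside G p).IsBipartite) :
    weight w G + weight w (inside G p) ≤ 2 * mac G w := by
  classical
  have := Fintype.ofFinite ι
  let s : (inside G p).Coloring Bool := hp.toColoring (by simp)
  have hcount (e : Sym2 V) (he : e ∈ G.edgeFinset) :
      ∑ σ, 2 * (if e ∈ (cut G (flippedSide s p σ)).edgeSet then w e else 0) =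
        Fintype.card (ι → Bool) * (w e + if e ∈ (inside G p).edgeSet then w e else 0) := by
    have hcard := congrArg (Nat.cast (R := ℝ))
      (two_mul_card_mem_cut_flippedSide s (SimpleGraph.mem_edgeFinset.1 he))
    push_cast at hcard
    rw [← Finset.mul_sum, ← Finset.sum_filter, Finset.sum_const, nsmul_eq_mul, ← mul_assoc, hcard]
    split_ifs <;> ring
  refine le_of_mul_le_mul_left (a := (Fintype.card (ι → Bool) : ℝ)) ?_ (by positivity)
  calc (Fintype.card (ι → Bool) : ℝ) * (weight w G + weight w (inside G p))
      = ∑ σ, 2 * weight w (cut G (flippedSide s p σ)) := by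
        simp only [weight_eq_sum_ite w (inside_le G p), weight_eq_sum_ite w (cut_le G _),
          Finset.mul_sum]
        rw [Finset.sum_comm, Finset.sum_congr rfl hcount, weight, ← Finset.sum_add_distrib,
          Finset.mul_sum]
    _ ≤ ∑ _σ : ι → Bool, 2 * mac G w := by
        gcongr with σ
        exact Finset.le_sup' (fun A : Finset V => weight w (cut G A))
          (Finset.mem_univ (flippedSide s p σ))
    _ = Fintype.card (ι → Bool) * (2 * mac G w) := by
        rw [Finset.sum_const, Finset.card_univ, nsmul_eq_mul]

end RandomCut

section Main

variable {V : Type*} [Fintype V] {G M : SimpleGraph V} (w : Sym2 V → ℝ)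

theorem weight_add_weight_inside_le_two_mul_mac_of_cliqueFree_three {ι : Type*} [Finite ι]
    [DecidableEq ι] (hG : G.CliqueFree 3) {p : V → ι}
    (hp : ∀ i, Finset.card {v | p v = i} ≤ 4) :
    weight w G + weight w (inside G p) ≤ 2 * mac G w := by
  refine weight_add_weight_inside_le_two_mul_mac G w (isBipartite_inside fun i => ?_)
  let := Fintype.ofFinite (p ⁻¹' {i})
  refine isBipartite_of_cliqueFree_three_of_card_le_four
    (hG.comap (SimpleGraph.Embedding.induce _).isContained) ?_
  exact (Fintype.card_of_subtype {v | p v = i} (by simp)).trans_le (hp i)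

theorem weight_le_mac_of_isBipartite (hG : G.IsBipartite) : weight w G ≤ mac G w := by
  have h := weight_add_weight_inside_le_two_mul_mac G w (p := fun _ => ()) (by rwa [inside_const])
  rw [inside_const] at h
  linarith

open Classical in
theorem IsMatching.weight_add_weight_add_weight_le_two_mul_mac [Fintype M.ConnectedComponent]
    (hG : G.CliqueFree 3) (hM : IsMatching M) (hMG : M ≤ G)
    {N : SimpleGraph M.ConnectedComponent} (hN : IsMatching N)
    (hNG : N ≤ G.map M.connectedComponentMk) :
    weight w G + (weight w M + weight (pushWeight G w M.connectedComponentMk) N) ≤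
      2 * mac G w := by
  have hfiber := card_fiber_comp_le hM.card_fiber_connectedComponentMk_le_two
    hN.card_fiber_connectedComponentMk_le_two
  have h := weight_add_weight_inside_le_two_mul_mac_of_cliqueFree_three w hG hfiber
  rwa [weight_inside_comp, hM.inside_connectedComponentMk hMG,
    hN.inside_connectedComponentMk hNG] at h

theorem IsMatching.exists_isMatching_map_weight_le [Fintype M.ConnectedComponent]
    [DecidableRel G.Adj] (hM : IsMatching M) (hMG : M ≤ G) {Δ : ℕ} (hΔ : 2 ≤ Δ)
    (hG : G.maxDegree ≤ Δ) :
    ∃ N ≤ G.map M.connectedComponentMk, IsMatching N ∧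
      weight w G ≤ weight w M +
        (2 * Δ - 1) * weight (pushWeight G w M.connectedComponentMk) N := by
  classical
  obtain ⟨N, hNG, hN, hle⟩ := exists_isMatching_weight_le
    (pushWeight G w M.connectedComponentMk) (hM.maxDegree_map_le hMG hΔ hG)
  refine ⟨N, hNG, hN, ?_⟩
  have hcast : ((2 * Δ - 2 : ℕ) : ℝ) + 1 = 2 * Δ - 1 := by
    rw [Nat.cast_sub (by omega)]
    push_cast
    ring
  rw [hcast] at hle
  rw [weight_eq_weight_add_weight_map G w M.connectedComponentMk,
    hM.inside_connectedComponentMk hMG]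
  exact add_le_add_right hle _

theorem weight_mul_le_two_mul_mac_of_two_le [DecidableRel G.Adj] (hG : G.CliqueFree 3) {Δ : ℕ}
    (hΔ : 2 ≤ Δ) (hG' : G.maxDegree ≤ Δ) :
    (1 + (3 * (Δ : ℝ) - 1) / ((2 * Δ - 1) * (Δ + 1))) * weight w G ≤ 2 * mac G w := by
  classical
  obtain ⟨M, hMG, hM, hweightM⟩ := exists_isMatching_weight_le w hG'
  obtain ⟨N, hNG, hN, hweightN⟩ := hM.exists_isMatching_map_weight_le w hMG hΔ hG'
  have hmac := hM.weight_add_weight_add_weight_le_two_mul_mac w hG hMG hN hNG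
  have hΔ' : (2 : ℝ) ≤ Δ := mod_cast hΔ
  have hpos : (0 : ℝ) < (2 * Δ - 1) * (Δ + 1) := by nlinarith
  refine le_trans ?_ hmac
  rw [add_mul, one_mul, add_le_add_iff_left, div_mul_eq_mul_div, div_le_iff₀ hpos]
  nlinarith [mul_le_mul_of_nonneg_left hweightN (by linarith : (0 : ℝ) ≤ Δ + 1),
    mul_le_mul_of_nonneg_left hweightM (by linarith : (0 : ℝ) ≤ 2 * Δ - 2)]

end Main

end WeightedCut

theorem mainTheorem3_general {V : Type*} [Fintype V] (G : SimpleGraph V) [DecidableRel G.Adj]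
    (w : Sym2 V → ℝ) (hG : G.CliqueFree 3) (Δ : ℕ) (hΔ : G.maxDegree ≤ Δ) :
    (1 / 2 + (3 * (Δ : ℝ) - 1) / (4 * (Δ : ℝ) ^ 2 + 2 * (Δ : ℝ) - 2)) * WeightedCut.weight w G
      ≤ WeightedCut.mac G w := by
  rcases Nat.lt_or_ge Δ 2 with hlt | hge
  · have h := WeightedCut.weight_le_mac_of_isBipartite w
      (isBipartite_of_maxDegree_le_one (G := G) (by omega))
    interval_cases Δ <;> norm_num <;> exact h
  · have h := WeightedCut.weight_mul_le_two_mul_mac_of_two_le w hG hge hΔ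
    have hfactor : 4 * (Δ : ℝ) ^ 2 + 2 * Δ - 2 = (2 * Δ - 1) * (Δ + 1) * 2 := by ring
    rw [hfactor, ← div_div]
    linarith

theorem mainTheorem3 {V : Type*} [Fintype V] (G : SimpleGraph V) [DecidableRel G.Adj]
    (w : Sym2 V → ℝ) (hw : ∀ e ∈ G.edgeSet, 0 ≤ w e)
    (hG : G.CliqueFree 3) (Δ : ℕ) (hΔ : G.maxDegree ≤ Δ) :
    (1 / 2 + (3 * (Δ : ℝ) - 1) / (4 * (Δ : ℝ) ^ 2 + 2 * (Δ : ℝ) - 2)) * WeightedCut.weight w G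
      ≤ WeightedCut.mac G w :=
  mainTheorem3_general G w hG Δ hΔ
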